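/- Let $k$ be a (left) Noetherian ring. An FI-module over $k$ is a functor $V$ from the category FI of finite sets and injections to the category of (left) $k$-modules, and a sub-FI-module of $V$ is a family of submodules $W(S)\subseteq V(S)$, one for each finite set $S$, preserved by all maps induced by injections. Write $V_n := V(\{1,\dots,n\})$; $V$ is finitely generated if there is a finite set of elements of $\coprod_{n\ge 0} V_n$ that is contained in no proper sub-FI-module of $V$. Let $E_r^{p,q}$ ($r\ge 2$, $p,q\ge 0$) be a first-quadrant cohomological spectral sequence of FI-modules over $k$, with differentials $d_r\colon E_r^{p,q}\to E_r^{p+r,\,q-r+1}$, and suppose that it converges to a sequence of FI-modules $H^n=H^n(X;k)$, $n\ge 0$: each $H^n$ has a filtration by sub-FI-modules $H^n=F^0H^n\supseteq F^1H^n\supseteq\cdots\supseteq F^{n+1}H^n=0$ with isomorphisms of FI-modules $F^pH^n/F^{p+1}H^n\cong E_\infty^{p,n-p}$ for $0\le p\le n$, where $E_\infty^{p,q}$ is the common value of $E_r^{p,q}$ for $r\ge\max(p+1,q+2)$. If the FI-module $E_2^{p,q}$ is finitely generated for all $p,q\ge 0$, then the FI-module $H^i(X;k)$ is finitely generated for every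 $i\ge 0$. -/

import Mathlib

open CategoryTheory CategoryTheory.Limits

universe v u

/-- An object of the category `FI`: a finite set (the empty set is allowed). -/
structure FI : Type 1 where
  of ::
  carrier : Type
  [finite : Finite carrier]

namespace FI

/-- Morphisms of `FI` are the injections. -/
instance : Category FI where
  Hom S T := S.carrier ↪ T.carrier
  id S := Function.Embedding.refl S.carrier
  comp f g := Function.Embedding.trans f g

/-- The standard set with `n` elements, as an object of `FI`. -/
def std (n : ℕ) : FI := FI.of (Fin n)

end FI

/-- An `FI`-module over `k`: a functor from finite sets and injections to (left) `k`-modules.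
Morphisms of `FI`-modules are the natural transformations. -/
abbrev FIModule (k : Type u) [Ring k] := FI ⥤ ModuleCat.{v} k

namespace FIModule

variable {k : Type u} [Ring k]

/-- A sub-`FI`-module of `V`: a submodule of `V(S)` for every finite set `S`, such that these are
preserved by the maps induced by injections. -/
structure Sub (V : FIModule.{v} k) where
  obj (S : FI) : Submodule k (V.obj S)
  map_mem {S T : FI} (f : S ⟶ T) (x : V.obj S) : x ∈ obj S → (V.map f).hom x ∈ obj T

/-- `V` is finitely generated if there is a finite set `s` of elements of `∐ₙ Vₙ`
(where `Vₙ` is the value of `V` on the standard set with `n` elements) such that the only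
sub-`FI`-module of `V` containing `s` is `V` itself. -/
def IsFinitelyGenerated (V : FIModule.{v} k) : Prop :=
  ∃ s : Set (Σ n : ℕ, V.obj (FI.std n)), s.Finite ∧
    ∀ W : Sub V, (∀ x ∈ s, x.2 ∈ W.obj (FI.std x.1)) → ∀ S : FI, W.obj S = ⊤

end FIModule

namespace FirstQuadrant

variable {C : Type*} [Category C] [Abelian C]

/-- The `r`-th page (`2 ≤ r`) at position `(p, q)`. -/
noncomputable abbrev term (E : E₂CohomologicalSpectralSequenceNat C) (r : ℤ) (p q : ℕ)
    (hr : 2 ≤ r := by lia) : C :=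
  (E.page r hr).X (p, q)

/-- In a first quadrant spectral sequence no nonzero differential enters or leaves position
`(p, q)` on the pages `r ≥ max (p + 1) (q + 2)`, so the terms there are all the same. -/
theorem term_succ_iso (E : E₂CohomologicalSpectralSequenceNat C) (p q : ℕ) (r : ℤ)
    (hr : max ((p : ℤ) + 1) (q + 2) ≤ r) :
    Nonempty (term E r p q ≅ term E (r + 1) p q) := by
  have h2 : 2 ≤ r := by lia
  have hf : ∀ pq, (E.page r h2).d (p, q) pq = 0 := fun pq =>
    (E.page r h2).shape _ _ (by
      rw [ComplexShape.spectralSequenceNat_rel_iff]; dsimp only; lia)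
  have ht : ∀ pq, (E.page r h2).d pq (p, q) = 0 := fun pq =>
    (E.page r h2).shape _ _ (by
      rw [ComplexShape.spectralSequenceNat_rel_iff]; dsimp only; lia)
  have := ((E.page r h2).sc (p, q)).isIso_iCycles (hf _)
  have := ((E.page r h2).sc (p, q)).isIso_homologyπ (ht _)
  exact ⟨(asIso ((E.page r h2).sc (p, q)).iCycles).symm ≪≫
    asIso ((E.page r h2).sc (p, q)).homologyπ ≪≫ E.iso r (r + 1) (p, q)⟩

/-- The term `E_∞^{p,q}` of a first quadrant spectral sequence: the common value (up to
isomorphism) of `E_r^{p,q}` for `r ≥ max (p + 1) (q + 2)`. -/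
noncomputable def infTerm (E : E₂CohomologicalSpectralSequenceNat C) (p q : ℕ) : C :=
  term E (max ((p : ℤ) + 1) (q + 2)) p q

/-- Convergence `E_r^{p,q} ⇒ H^{p+q}` of a first quadrant spectral sequence: every `Hⁿ` has a
decreasing filtration `Hⁿ = F⁰Hⁿ ⊇ F¹Hⁿ ⊇ ⋯ ⊇ Fⁿ⁺¹Hⁿ = 0` by subobjects together with
isomorphisms `FᵖHⁿ / Fᵖ⁺¹Hⁿ ≅ E_∞^{p,q}` for all `p + q = n`. -/
structure ConvergesTo (E : E₂CohomologicalSpectralSequenceNat C) (H : ℕ → C) where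
  F (n p : ℕ) : Subobject (H n)
  antitone (n : ℕ) : Antitone (F n)
  F_zero (n : ℕ) : F n 0 = ⊤
  F_last (n : ℕ) : F n (n + 1) = ⊥
  gradedIso (n p q : ℕ) (hpq : p + q = n) :
    cokernel (Subobject.ofLE (F n (p + 1)) (F n p) (antitone n p.le_succ)) ≅ infTerm E p q

end FirstQuadrant

/-! Over a noetherian ring, finite generation of FI-modules passes to quotients, extensions and (the
hard case) submodules. Each page is a subquotient of the previous one, so all terms, including
`infTerm`, are finitely generated; descending induction along the filtration then reaches `H i`.

Submodules are handled by a Gröbner argument, adjoining one generator `s` in degree `n` at a time to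
a noetherian `A`. Modulo `A`, elements are combinations of translates of `s` by injections, ordered
lexicographically. These translates may be dependent, so a leading coefficient is any one realised
modulo lower terms. Leading coefficients form left ideals that grow along increasing maps; Higman's
lemma and noetherianity of `k` leave finitely many to control. -/

/-- Gröbner-style reduction: if every element of `W` can be reduced modulo `W'` so as to lower its
leading term, then `W ≤ W'`, up to elements of `A`. -/
theorem Submodule.inf_sup_span_range_le_of_reduction {R M ι : Type*} [Ring R] [AddCommGroup M]
    [Module R M] [LinearOrder ι] [Finite ι] (b : ι → M) (A W W' : Submodule R M) (hW : W' ≤ W)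
    (hA : W ⊓ A ≤ W')
    (hred : ∀ (e : ι) (x : M) (c : R), x ∈ W →
      x - c • b e ∈ A ⊔ Submodule.span R (b '' Set.Iio e) →
      ∃ y ∈ W', x - y ∈ A ⊔ Submodule.span R (b '' Set.Iio e)) :
    W ⊓ (A ⊔ Submodule.span R (Set.range b)) ≤ W' := by
  have := Fintype.ofFinite ι
  suffices h : ∀ T : Finset ι, IsLowerSet (T : Set ι) →
      W ⊓ (A ⊔ Submodule.span R (b '' T)) ≤ W' by
    have := h Finset.univ (by simpa using isLowerSet_univ)
    rwa [Finset.coe_univ, Set.image_univ] at this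
  intro T
  induction T using Finset.induction_on_max with
  | empty => simpa using fun _ => hA
  | insert a T hT ih =>
    intro hlow
    -- A lower set with maximum `a` is `T` together with `a`, so "terms below `a`" are exactly those
    -- of the previous stage.
    have hIio : (T : Set ι) = Set.Iio a := by
      ext x
      refine ⟨fun hx => hT x hx, fun hx => ?_⟩
      have := hlow (le_of_lt hx) (by simp : a ∈ ((insert a T : Finset ι) : Set ι))
      simpa [ne_of_lt hx] using this
    rw [hIio] at ih
    rintro x ⟨hxW, hx⟩
    rw [Finset.coe_insert, hIio, Set.image_insert_eq, Submodule.span_insert, sup_left_comm,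
      SetLike.mem_coe, Submodule.mem_sup] at hx
    obtain ⟨y, hy, z, hz, rfl⟩ := hx
    obtain ⟨c, rfl⟩ := Submodule.mem_span_singleton.1 hy
    obtain ⟨w, hw, hxw⟩ := hred a _ c hxW (by simpa using hz)
    have := ih (isLowerSet_Iio a) ⟨W.sub_mem hxW (hW hw), hxw⟩
    simpa using W'.add_mem this hw

/-- A monotone map from a well-quasi-order to a noetherian lattice of submodules takes only
finitely many values up to the quasi-order. -/
theorem WellQuasiOrdered.exists_finset_of_monotone_submodule {α R M : Type*} [Ring R]
    [AddCommGroup M] [Module R M] [IsNoetherian R M] {r : α → α → Prop} [IsPreorder α r]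
    (hr : WellQuasiOrdered r) (J : α → Submodule R M) (hJ : ∀ a b, r a b → J a ≤ J b) :
    ∃ T : Finset α, ∀ a, ∃ t ∈ T, r t a ∧ J a ≤ J t := by
  by_contra! hcon
  -- Failure for every finite set yields a sequence in which no term dominates a later one; the
  -- ideals along a monotone subsequence stabilize, a contradiction.
  obtain ⟨f, -, hf⟩ := exists_seq_of_forall_finset_exists (fun _ : α => True)
    (fun x y => r x y → ¬ J y ≤ J x) fun s _ => by
      obtain ⟨a, ha⟩ := hcon s
      exact ⟨a, trivial, ha⟩
  obtain ⟨g, hg⟩ := hr.exists_monotone_subseq f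
  obtain ⟨n, hn⟩ := monotone_stabilizes_iff_noetherian.2 ‹IsNoetherian R M›
    ⟨fun i => J (f (g i)), fun i j hij => hJ _ _ (hg i j hij)⟩
  exact hf _ _ (g.strictMono n.lt_succ_self) (hg _ _ n.le_succ) (hn _ n.le_succ).ge

/-! ### Divisibility of injections and Higman's lemma -/

namespace FI

/-- Injections `Fin n → Fin N`, ordered lexicographically. -/
abbrev LexInj (n N : ℕ) := {f : Lex (Fin n → Fin N) // Function.Injective (ofLex f)}

namespace LexInj

variable {n N N' : ℕ}

/-- The morphism of `FI` given by an injection. -/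
def hom (f : LexInj n N) : std n ⟶ std N := (⟨ofLex f.1, f.2⟩ : Fin n ↪ Fin N)

/-- An injection from a morphism of `FI`. -/
def ofHom (f : std n ⟶ std N) : LexInj n N :=
  ⟨toLex (DFunLike.coe (F := Fin n ↪ Fin N) f), (f : Fin n ↪ Fin N).injective⟩

/-- Postcomposition with an increasing map. -/
def comp (g : Fin N ↪o Fin N') (f : LexInj n N) : LexInj n N' :=
  ⟨toLex (g ∘ ofLex f.1), g.injective.comp f.2⟩

/-- The morphism of `FI` given by an increasing map. -/
def orderHom (g : Fin N ↪o Fin N') : std N ⟶ std N' := (g.toEmbedding : Fin N ↪ Fin N')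

theorem hom_comp (g : Fin N ↪o Fin N') (f : LexInj n N) :
    (f.comp g).hom = f.hom ≫ orderHom g := rfl

/-- This fails for arbitrary injections `g`, which is why divisibility uses increasing maps only. -/
theorem comp_lt_comp (g : Fin N ↪o Fin N') {f f' : LexInj n N} (h : f < f') :
    f.comp g < f'.comp g := by
  obtain ⟨i, hi, hlt⟩ := h
  exact ⟨i, fun j hj => congrArg g (hi j hj), g.strictMono hlt⟩

/-- Divisibility of injections into varying targets. -/
def Dvd (n : ℕ) (e e' : Σ N, LexInj n N) : Prop :=
  ∃ g : Fin e.1 ↪o Fin e'.1, e.2.comp g = e'.2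

instance : IsPreorder (Σ N, LexInj n N) (Dvd n) where
  refl _ := ⟨RelEmbedding.refl _, rfl⟩
  trans := by
    rintro e e' e'' ⟨g, hg⟩ ⟨g', hg'⟩
    exact ⟨g.trans g', by rw [← hg', ← hg]; rfl⟩

/-- The word recording the fibres of an injection. -/
def word (e : Σ N, LexInj n N) : List (Finset (Fin n)) :=
  List.ofFn fun x : Fin e.1 => Finset.univ.filter fun a => ofLex e.2.1 a = x

/-- A sublist embedding is an increasing `g` preserving letters: `a` lies in the fibre over its
image under `e`, hence in the fibre of `e'` over `g` of that image. -/
theorem dvd_of_sublist {e e' : Σ N, LexInj n N} (h : (word e).Sublist (word e')) :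
    Dvd n e e' := by
  obtain ⟨g, hg⟩ := List.sublist_iff_exists_fin_orderEmbedding_get_eq.1 h
  have hl : ∀ e : Σ N, LexInj n N, (word e).length = e.1 := fun e => List.length_ofFn
  refine ⟨((Fin.castOrderIso (hl e).symm).toOrderEmbedding.trans g).trans
    (Fin.castOrderIso (hl e')).toOrderEmbedding,
    Subtype.ext <| ofLex.injective <| funext fun a => ?_⟩
  have := hg (Fin.cast (hl e).symm (ofLex e.2.1 a))
  have ha : a ∈ (word e).get (Fin.cast (hl e).symm (ofLex e.2.1 a)) := by
    simp only [word, List.get_ofFn, Finset.mem_filter, Finset.mem_univ, true_and]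
    rfl
  rw [this] at ha
  simp only [word, List.get_ofFn, Finset.mem_filter, Finset.mem_univ, true_and] at ha
  exact ha.symm

/-- Higman's lemma for words over the finite alphabet of subsets of `Fin n`, compared by equality.
-/
theorem wellQuasiOrdered_dvd (n : ℕ) : WellQuasiOrdered (Dvd n) := by
  intro f
  have h := Set.PartiallyWellOrderedOn.partiallyWellOrderedOn_sublistForall₂
    (Eq : Finset (Fin n) → _ → Prop) (Set.toFinite Set.univ).partiallyWellOrderedOn
  obtain ⟨i, j, hij, h⟩ := h.exists_lt (f := fun i => word (f i)) (by simp)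
  refine ⟨i, j, hij, dvd_of_sublist ?_⟩
  obtain ⟨l, hl, hl'⟩ := List.sublistForall₂_iff.1 h
  rw [List.forall₂_eq_eq_eq] at hl
  exact hl ▸ hl'

end LexInj

theorem exists_iso_std (S : FI) : ∃ n, Nonempty (std n ≅ S) := by
  have := S.finite
  obtain ⟨n, ⟨e⟩⟩ := Finite.exists_equiv_fin S.carrier
  exact ⟨n, ⟨{
    hom := (e.symm.toEmbedding : Fin n ↪ S.carrier)
    inv := (e.toEmbedding : S.carrier ↪ Fin n)
    hom_inv_id := DFunLike.ext (F := Fin n ↪ Fin n) _ _ fun x => e.apply_symm_apply x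
    inv_hom_id := DFunLike.ext (F := S.carrier ↪ S.carrier) _ _ fun x => e.symm_apply_apply x }⟩⟩

end FI

/-! ### Noetherianity of finitely generated FI-modules -/

namespace FIModule

variable {k : Type u} [Ring k]

namespace Sub

variable {V : FIModule.{v} k}

/-- The intersection of two sub-`FI`-modules. -/
def inter (W W' : Sub V) : Sub V where
  obj S := W.obj S ⊓ W'.obj S
  map_mem f x hx := ⟨W.map_mem f x hx.1, W'.map_mem f x hx.2⟩

/-- The sub-`FI`-module generated by `A` and an element of `V(S₀)`. -/
def adjoin (A : Sub V) {S₀ : FI} (s : V.obj S₀) : Sub V where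
  obj S := A.obj S ⊔ Submodule.span k (Set.range fun f : S₀ ⟶ S => (V.map f).hom s)
  map_mem {S T} f x hx := by
    suffices h : A.obj S ⊔ Submodule.span k (Set.range fun f : S₀ ⟶ S => (V.map f).hom s) ≤
        Submodule.comap (V.map f).hom
          (A.obj T ⊔ Submodule.span k (Set.range fun f : S₀ ⟶ T => (V.map f).hom s)) from h hx
    refine sup_le (fun y hy => ?_) ?_
    · exact Submodule.mem_sup_left (A.map_mem f y hy)
    · rw [Submodule.span_le]
      rintro _ ⟨g, rfl⟩
      refine Submodule.mem_sup_right (Submodule.subset_span ⟨g ≫ f, ?_⟩)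
      simp

/-- Finite generation of a sub-`FI`-module. -/
def IsFG (W : Sub V) : Prop :=
  ∃ s : Set (Σ n : ℕ, V.obj (FI.std n)), s.Finite ∧ (∀ x ∈ s, x.2 ∈ W.obj (FI.std x.1)) ∧
    ∀ W' : Sub V, (∀ x ∈ s, x.2 ∈ W'.obj (FI.std x.1)) → ∀ S, W.obj S ≤ W'.obj S

/-- A sub-`FI`-module is noetherian if all smaller ones are finitely generated. -/
def IsNoeth (A : Sub V) : Prop :=
  ∀ W : Sub V, (∀ S, W.obj S ≤ A.obj S) → W.IsFG

theorem obj_le_of_std {W W' : Sub V} (h : ∀ n, W.obj (FI.std n) ≤ W'.obj (FI.std n)) (S : FI) :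
    W.obj S ≤ W'.obj S := by
  obtain ⟨n, ⟨e⟩⟩ := FI.exists_iso_std S
  intro x hx
  have := W'.map_mem e.hom _ (h n (W.map_mem e.inv x hx))
  rwa [← LinearMap.comp_apply, ← ModuleCat.hom_comp, ← V.map_comp, e.inv_hom_id, V.map_id] at this

section Groebner

variable {n : ℕ} (A : Sub V) (s : V.obj (FI.std n))

/-- The elements of `V` that are congruent modulo `A` to combinations of translates of `s` by
injections smaller than `e`. -/
def lower {N : ℕ} (e : FI.LexInj n N) : Submodule k (V.obj (FI.std N)) :=
  A.obj (FI.std N) ⊔ Submodule.span k ((fun f : FI.LexInj n N => (V.map f.hom).hom s) '' Set.Iio e)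

theorem map_mem_lower {N N' : ℕ} (g : Fin N ↪o Fin N') (e : FI.LexInj n N)
    {x : V.obj (FI.std N)} (hx : x ∈ lower A s e) :
    (V.map (FI.LexInj.orderHom g)).hom x ∈ lower A s (e.comp g) := by
  suffices h : lower A s e ≤ (lower A s (e.comp g)).comap (V.map (FI.LexInj.orderHom g)).hom from
    h hx
  refine sup_le (fun y hy => ?_) ?_
  · exact Submodule.mem_sup_left (A.map_mem _ y hy)
  · rw [Submodule.span_le]
    rintro _ ⟨f, hf, rfl⟩
    refine Submodule.mem_sup_right (Submodule.subset_span
      ⟨f.comp g, FI.LexInj.comp_lt_comp g hf, ?_⟩)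
    simp [FI.LexInj.hom_comp]

/-- The left ideal of leading coefficients at `e` of elements of `W`. -/
def leadingIdeal (W : Sub V) (e : Σ N, FI.LexInj n N) : Submodule k k where
  carrier := {c | ∃ x ∈ W.obj (FI.std e.1), x - c • (V.map e.2.hom).hom s ∈ lower A s e.2}
  zero_mem' := ⟨0, zero_mem _, by simp⟩
  add_mem' := by
    rintro c d ⟨x, hx, hx'⟩ ⟨y, hy, hy'⟩
    refine ⟨x + y, add_mem hx hy, ?_⟩
    rw [add_smul, add_sub_add_comm]
    exact add_mem hx' hy'
  smul_mem' := by
    rintro a c ⟨x, hx, hx'⟩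
    refine ⟨a • x, Submodule.smul_mem _ _ hx, ?_⟩
    rw [smul_eq_mul, mul_smul, ← smul_sub]
    exact Submodule.smul_mem _ _ hx'

theorem leadingIdeal_mono_of_dvd (W : Sub V) {e e' : Σ N, FI.LexInj n N}
    (h : FI.LexInj.Dvd n e e') : leadingIdeal A s W e ≤ leadingIdeal A s W e' := by
  obtain ⟨g, hg⟩ := h
  rintro c ⟨x, hx, hx'⟩
  refine ⟨_, W.map_mem (FI.LexInj.orderHom g) x hx, ?_⟩
  rw [← hg]
  have := map_mem_lower A s g e.2 hx'
  simpa [FI.LexInj.hom_comp] using this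

/-- Generators of `W` are those of its intersection with `A`, plus elements realising generators of
the finitely many leading ideals. If `W'` contains them, every element of `W` reduces to zero modulo
`W.inter W'`. -/
theorem IsNoeth.adjoin [IsNoetherianRing k] {A : Sub V} (hA : A.IsNoeth) (s : V.obj (FI.std n)) :
    (A.adjoin s).IsNoeth := by
  intro W hW
  obtain ⟨s₀, hs₀, hs₀W, hs₀A⟩ := hA (W.inter A) fun S => inf_le_right
  obtain ⟨T, hT⟩ := (FI.LexInj.wellQuasiOrdered_dvd n).exists_finset_of_monotone_submodule
    (leadingIdeal A s W) fun a b => leadingIdeal_mono_of_dvd A s W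
  choose G hG using fun e => IsNoetherian.noetherian (leadingIdeal A s W e)
  have hGmem : ∀ e, ∀ c : G e, (c : k) ∈ leadingIdeal A s W e := fun e c =>
    (hG e).le (Submodule.subset_span c.2)
  choose x hxW hx using hGmem
  refine ⟨s₀ ∪ ⋃ e ∈ T, Set.range fun c : G e => ⟨e.1, x e c⟩,
    hs₀.union (T.finite_toSet.biUnion fun e _ => Set.finite_range _), ?_, fun W' hW' => ?_⟩
  · rintro y (hy | hy)
    · exact (hs₀W y hy).1
    · simp only [Set.mem_iUnion] at hy
      obtain ⟨e, -, c, rfl⟩ := hy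
      exact hxW e c
  have hlead : ∀ e ∈ T, leadingIdeal A s W e ≤ leadingIdeal A s (W.inter W') e := by
    intro e he
    rw [← hG e, Submodule.span_le]
    intro c hc
    refine ⟨x e ⟨c, hc⟩, ⟨hxW e _, hW' ⟨e.1, x e ⟨c, hc⟩⟩ (Or.inr ?_)⟩, hx e ⟨c, hc⟩⟩
    simp only [Set.mem_iUnion]
    exact ⟨e, he, ⟨c, hc⟩, rfl⟩
  suffices h : ∀ N, W.obj (FI.std N) ≤ (W.inter W').obj (FI.std N) from
    obj_le_of_std fun N => (h N).trans inf_le_right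
  intro N
  refine le_trans (le_inf le_rfl ((hW _).trans (sup_le_sup_left (Submodule.span_mono ?_) _)))
    (Submodule.inf_sup_span_range_le_of_reduction
    (fun f : FI.LexInj n N => (V.map f.hom).hom s) (A.obj _) (W.obj _) _ inf_le_left ?_ ?_)
  · rintro _ ⟨f, rfl⟩
    exact ⟨FI.LexInj.ofHom f, rfl⟩
  · exact le_inf inf_le_left (hs₀A W' (fun y hy => hW' y (Or.inl hy)) _)
  · intro e y c hy hyc
    -- The coefficient `c` at `e` already occurs at some `t` in `T` dividing `e`; realise it there
    -- inside `W.inter W'` and push it forward to `e`.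
    obtain ⟨t, htT, hte, hle⟩ := hT ⟨N, e⟩
    obtain ⟨z, hz, hzc⟩ := leadingIdeal_mono_of_dvd A s _ hte (hlead t htT (hle ⟨y, hy, hyc⟩))
    exact ⟨z, hz, by simpa using sub_mem hyc hzc⟩

end Groebner

theorem exists_isNoeth_of_finite [IsNoetherianRing k] {s : Set (Σ n : ℕ, V.obj (FI.std n))}
    (hs : s.Finite) : ∃ A : Sub V, A.IsNoeth ∧ ∀ x ∈ s, x.2 ∈ A.obj (FI.std x.1) := by
  induction s, hs using Set.Finite.induction_on with
  | empty =>
    refine ⟨⟨fun _ => ⊥, by simp⟩, fun W hW => ⟨∅, Set.finite_empty, by simp, fun W' _ S => ?_⟩,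
      by simp⟩
    exact (hW S).trans bot_le
  | @insert a s _ _ ih =>
    obtain ⟨A, hA, hsA⟩ := ih
    refine ⟨A.adjoin a.2, hA.adjoin a.2, ?_⟩
    rintro x (rfl | hx)
    · exact Submodule.mem_sup_right (Submodule.subset_span ⟨𝟙 _, by simp⟩)
    · exact Submodule.mem_sup_left (hsA x hx)

end Sub

/-! ### Quotients, submodules and extensions -/

namespace IsFinitelyGenerated

variable {V V' V'' : FIModule.{v} k}

/-- `FI`-modules over a noetherian ring are noetherian. -/
theorem isFG [IsNoetherianRing k] (h : V.IsFinitelyGenerated) (W : Sub V) : W.IsFG := by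
  obtain ⟨s, hs, hsV⟩ := h
  obtain ⟨A, hA, hsA⟩ := Sub.exists_isNoeth_of_finite hs
  exact hA W fun S => (hsV A hsA S).ge.trans' le_top

theorem app_surjective (f : V ⟶ V') [Epi f] (S : FI) : Function.Surjective (f.app S).hom :=
  (ModuleCat.epi_iff_surjective _).1 ((NatTrans.epi_iff_epi_app f).1 inferInstance S)

theorem app_injective (f : V ⟶ V') [Mono f] (S : FI) : Function.Injective (f.app S).hom :=
  (ModuleCat.mono_iff_injective _).1 ((NatTrans.mono_iff_mono_app f).1 inferInstance S)

theorem naturality_apply (f : V ⟶ V') {S T : FI} (g : S ⟶ T) (x : V.obj S) :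
    (f.app T).hom ((V.map g).hom x) = (V'.map g).hom ((f.app S).hom x) :=
  congrArg (fun h => h.hom x) (f.naturality g)

/-- The image of a sub-`FI`-module. -/
def subMap (f : V ⟶ V') (W : Sub V) : Sub V' where
  obj S := (W.obj S).map (f.app S).hom
  map_mem g x := by
    rintro ⟨y, hy, rfl⟩
    exact ⟨_, W.map_mem g y hy, naturality_apply f g y⟩

/-- The preimage of a sub-`FI`-module. -/
def subComap (f : V ⟶ V') (W : Sub V') : Sub V where
  obj S := (W.obj S).comap (f.app S).hom
  map_mem g x hx := by
    rw [Submodule.mem_comap, naturality_apply]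
    exact W.map_mem g _ hx

theorem of_epi (f : V ⟶ V') [Epi f] (h : V.IsFinitelyGenerated) : V'.IsFinitelyGenerated := by
  obtain ⟨s, hs, hsV⟩ := h
  refine ⟨(fun x => ⟨x.1, (f.app _).hom x.2⟩) '' s, hs.image _, fun W hW S => ?_⟩
  rw [eq_top_iff]
  intro y _
  obtain ⟨x, rfl⟩ := app_surjective f S y
  have := hsV (subComap f W) (fun x hx => hW _ ⟨x, hx, rfl⟩) S
  exact this.ge (Submodule.mem_top (x := x))

theorem of_mono [IsNoetherianRing k] (f : V ⟶ V') [Mono f] (h : V'.IsFinitelyGenerated) :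
    V.IsFinitelyGenerated := by
  obtain ⟨s, hs, hsV, hs'⟩ := h.isFG (subMap f ⟨fun _ => ⊤, by simp⟩)
  -- The generators of the image of `f` pull back to a finite set because `f` is injective in each
  -- degree.
  refine ⟨(fun x => ⟨x.1, (f.app _).hom x.2⟩) ⁻¹' s, hs.preimage ?_, fun W hW S => ?_⟩
  · rintro ⟨n, x⟩ - ⟨m, y⟩ - hxy
    obtain ⟨rfl, hxy⟩ := Sigma.mk.inj_iff.1 hxy
    exact congrArg (Sigma.mk n) (app_injective f _ (eq_of_heq hxy))
  · rw [eq_top_iff]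
    intro x _
    obtain ⟨y, hy, hyx⟩ := hs' (subMap f W) (fun y hy => by
      obtain ⟨x, -, hx⟩ := hsV y hy
      exact ⟨x, hW ⟨y.1, x⟩ (by simpa [hx] using hy), hx⟩) S ⟨x, trivial, rfl⟩
    exact app_injective f S hyx ▸ hy

theorem of_shortExact {X : ShortComplex (FIModule.{v} k)} (hX : X.ShortExact)
    (h₁ : X.X₁.IsFinitelyGenerated) (h₃ : X.X₃.IsFinitelyGenerated) :
    X.X₂.IsFinitelyGenerated := by
  obtain ⟨s, hs, hsV⟩ := h₁
  obtain ⟨t, ht, htV⟩ := h₃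
  have := hX.epi_g
  have hsurj := app_surjective X.g
  choose σ hσ using hsurj
  refine ⟨(fun x => ⟨x.1, (X.f.app _).hom x.2⟩) '' s ∪ (fun x => ⟨x.1, σ _ x.2⟩) '' t,
    (hs.image _).union (ht.image _), fun W hW S => ?_⟩
  have h1 := hsV (subComap X.f W) (fun x hx => hW _ (Or.inl ⟨x, hx, rfl⟩)) S
  have h3 := htV (subMap X.g W) (fun x hx =>
    ⟨_, hW ⟨x.1, σ _ x.2⟩ (Or.inr ⟨x, hx, rfl⟩), hσ _ _⟩) S
  rw [eq_top_iff]
  intro x _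
  obtain ⟨y, hy, hyx⟩ := h3.ge (Submodule.mem_top (x := (X.g.app S).hom x))
  have hex : (X.map ((evaluation FI (ModuleCat.{v} k)).obj S)).Exact :=
    hX.exact.map _
  obtain ⟨z, hz⟩ := (ShortComplex.moduleCat_exact_iff _).1 hex (x - y)
    (show (X.g.app S).hom (x - y) = 0 by rw [map_sub, hyx, sub_self])
  have hzW : (X.f.app S).hom z ∈ W.obj S := h1.ge (Submodule.mem_top (x := z))
  have hz' : (X.f.app S).hom z = x - y := hz
  rw [hz'] at hzW
  simpa using add_mem hzW hy

end IsFinitelyGenerated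

end FIModule

open FIModule

/-! ### Pages and the filtration of the limit -/

namespace FirstQuadrant

variable {k : Type u} [Ring k] [IsNoetherianRing k]

theorem isFinitelyGenerated_term (E : E₂CohomologicalSpectralSequenceNat (FIModule.{v} k))
    (hE : ∀ p q : ℕ, ((E.page 2 le_rfl).X (p, q)).IsFinitelyGenerated) (r : ℤ) (hr : 2 ≤ r)
    (p q : ℕ) : (term E r p q).IsFinitelyGenerated := by
  induction r, hr using Int.leInduction with
  | base => exact hE p q
  | succ r hr ih =>
    -- The next page is a quotient of the cycles, which embed in the current page.
    have := IsFinitelyGenerated.of_mono ((E.page r hr).iCycles (p, q)) ih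
    have := IsFinitelyGenerated.of_epi ((E.page r hr).homologyπ (p, q)) this
    exact IsFinitelyGenerated.of_epi (E.iso r (r + 1) (p, q)).hom this

theorem ConvergesTo.isFinitelyGenerated_filtration
    {E : E₂CohomologicalSpectralSequenceNat (FIModule.{v} k)} {H : ℕ → FIModule.{v} k}
    (hconv : ConvergesTo E H)
    (hE : ∀ p q : ℕ, ((E.page 2 le_rfl).X (p, q)).IsFinitelyGenerated) (n p : ℕ)
    (hp : p ≤ n + 1) : ((hconv.F n p : FIModule.{v} k)).IsFinitelyGenerated := by
  induction hp using Nat.decreasingInduction with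
  | self =>
    refine ⟨∅, Set.finite_empty, fun W _ S => ?_⟩
    have hz : IsZero ((hconv.F n (n + 1) : FIModule.{v} k)) := by
      rw [hconv.F_last]
      exact (isZero_zero _).of_iso Subobject.botCoeIsoZero
    have : Subsingleton ((hconv.F n (n + 1) : FIModule.{v} k).obj S) :=
      ModuleCat.subsingleton_of_isZero
        (((evaluation FI (ModuleCat.{v} k)).obj S).map_isZero hz)
    exact Submodule.eq_top_iff'.2 fun x => Subsingleton.elim 0 x ▸ zero_mem _
  | of_succ p hp ih =>
    let f := Subobject.ofLE (hconv.F n (p + 1)) (hconv.F n p) (hconv.antitone n p.le_succ)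
    have h₃ := IsFinitelyGenerated.of_epi (hconv.gradedIso n p (n - p) (by lia)).inv
      (isFinitelyGenerated_term E hE _ (by lia) p (n - p))
    exact IsFinitelyGenerated.of_shortExact
      (X := ShortComplex.mk f (cokernel.π f) (cokernel.condition f))
      { exact := ShortComplex.exact_cokernel f } ih h₃

end FirstQuadrant

theorem theorem4p6 {k : Type u} [Ring k] [IsNoetherianRing k]
    (E : E₂CohomologicalSpectralSequenceNat (FIModule.{v} k))
    (H : ℕ → FIModule.{v} k)
    (hconv : FirstQuadrant.ConvergesTo E H)
    (hE : ∀ p q : ℕ, ((E.page 2 le_rfl).X (p, q)).IsFinitelyGenerated)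
    (i : ℕ) :
    (H i).IsFinitelyGenerated := by
  have h := hconv.isFinitelyGenerated_filtration hE i 0 (Nat.zero_le _)
  have : IsIso (hconv.F i 0).arrow := by
    rw [hconv.F_zero]
    infer_instance
  exact FIModule.IsFinitelyGenerated.of_epi (hconv.F i 0).arrow h
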